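/- A decomposition of $\mathbb{R}^n$ is a collection of closed subsets of $\mathbb{R}^n$ (its pieces) with pairwise disjoint interiors whose union is $\mathbb{R}^n$; it is locally finite if every compact subset of $\mathbb{R}^n$ meets only finitely many pieces. Let $n \ge 1$. Then there is no locally finite decomposition of $\mathbb{R}^n$ into pieces of uniformly bounded (Euclidean) diameter such that every point of $\mathbb{R}^n$ lies in at most $n$ of the pieces. -/

import Mathlib

open scoped NNReal ENNReal

/-- A decomposition of a topological space: a collection of closed subsets (the pieces) with
pairwise disjoint interiors which together cover the space. -/
structure IsDecomposition {X : Type*} [TopologicalSpace X] (D : Set (Set X)) : Prop where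
  isClosed : ∀ A ∈ D, IsClosed A
  sUnion_eq : ⋃₀ D = Set.univ
  disjoint_interior : ∀ A ∈ D, ∀ B ∈ D, A ≠ B → Disjoint (interior A) (interior B)

/-- Every compact subset of the space meets only finitely many members of the collection. -/
def IsLocallyFiniteCollection {X : Type*} [TopologicalSpace X] (D : Set (Set X)) : Prop :=
  ∀ K : Set X, IsCompact K → {A ∈ D | (A ∩ K).Nonempty}.Finite

/-- The members of the collection have (uniformly) bounded diameter. The diameter is the extended
one, so that an unbounded set has diameter `∞`. -/
def HasBoundedDiameters {X : Type*} [PseudoEMetricSpace X] (D : Set (Set X)) : Prop :=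
  ∃ s : ℝ≥0, ∀ A ∈ D, Metric.ediam A ≤ (s : ℝ≥0∞)

/-- The members of the collection meet at most `n` at a point: no point lies in more than `n`
of them. -/
def MeetAtMost {X : Type*} (n : ℕ) (D : Set (Set X)) : Prop :=
  ∀ x : X, {A ∈ D | x ∈ A}.encard ≤ (n : ℕ∞)

/-!
The theorem is Lebesgue's covering theorem; of the properties of a decomposition, only that its
pieces are closed and cover the space is needed.

Take a cube whose side exceeds the diameter of all pieces. Colour a piece by the first coordinate
`i < n` such that it meets the face `x i = 0` of the cube, and by `n` if there is no such `i`. On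
the face `x i = 0` only colours at most `i` occur, and on the face `x i = 1` the colour `i` does
not occur, since no piece reaches from one face to the opposite one. Local finiteness makes the
union of the pieces of each colour closed in the cube, so
`nonempty_iInter_of_closed_cover_cube` gives a point at which all `n + 1` colours, and hence
`n + 1` distinct pieces, meet.

That covering lemma follows by compactness from Kuhn's cubical form of Sperner's lemma,
`exists_unit_cube_all_labels`: every labelling of a lattice box that satisfies the same boundary
conditions has a unit cube whose vertices carry all labels `0, …, n`. Kuhn's lemma holds by a parity
count over the Freudenthal triangulation (`sum_chainSum_range_eq_one`), by induction on the
dimension. Modulo `2`, the number of fully labelled simplices in a unit cube is a sum over the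
facets of the cube (`chainSum_facetSum`), facets common to two cubes cancel
(`sum_latticeBox_telescope`), and by the boundary conditions only the face on which the last
coordinate vanishes contributes.
-/

/-! ### Simplices of a unit cube and their facets -/

/-- The sum of `G` over all maximal chains of length `d` that start at the lattice point `v` and
increase one coordinate by `1` in each step, the coordinates being distinct elements of `S`.
`G` is evaluated at the multiset of labels (under `c`) of the `d + 1` points of the chain. For
`d = #S` these chains are the simplices of the Freudenthal triangulation of the unit cube at `v`
in the directions of `S`. -/
def chainSum {ι : Type*} [DecidableEq ι] (c : (ι → ℕ) → ℕ) :
    ℕ → Finset ι → (ι → ℕ) → (Multiset ℕ → ZMod 2) → ZMod 2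
  | 0, _, v, G => G {c v}
  | d + 1, S, v, G =>
    ∑ i ∈ S, chainSum c d (S.erase i) (v + Pi.single i 1) fun m => G (c v ::ₘ m)

/-- The sum of `G` over the facets of a simplex with label multiset `m`; a facet is given by leaving
out one vertex, that is, one element of `m` counted with multiplicity. -/
def facetSum (G : Multiset ℕ → ZMod 2) (m : Multiset ℕ) : ZMod 2 :=
  (m.map fun a => G (m.erase a)).sum

theorem facetSum_cons (G : Multiset ℕ → ZMod 2) (a : ℕ) (m : Multiset ℕ) :
    facetSum G (a ::ₘ m) = G m + facetSum (fun l => G (a ::ₘ l)) m := by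
  unfold facetSum
  rw [Multiset.map_cons, Multiset.sum_cons, Multiset.erase_cons_head]
  congr 2
  refine Multiset.map_congr rfl fun b hb => ?_
  by_cases h : a = b
  · subst h
    simp only [Multiset.erase_cons_head, Multiset.cons_erase hb]
  · rw [Multiset.erase_cons_tail _ h]

/-- A simplex with `d + 1` vertices and labels at most `d` has an odd number of facets labelled
`0, …, d - 1` exactly when it is labelled `0, …, d`: a label that occurs twice yields two such
facets. -/
theorem facetSum_range (d : ℕ) (m : Multiset ℕ) (hcard : m.card = d + 1)
    (hle : ∀ a ∈ m, a ≤ d) :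
    facetSum (fun l => if l = Multiset.range d then 1 else 0) m =
      if m = Multiset.range (d + 1) then 1 else 0 := by
  unfold facetSum
  by_cases h : ∃ a ∈ m, m.erase a = Multiset.range d
  · obtain ⟨a, ha, hma⟩ := h
    have hm : m = a ::ₘ Multiset.range d := by rw [← hma, Multiset.cons_erase ha]
    have key : ∀ b ∈ m, (if m.erase b = Multiset.range d then (1 : ZMod 2) else 0) =
        if a = b then 1 else 0 := by
      intro b hb
      congr 1
      refine propext ⟨fun h => ?_, fun h => h ▸ hma⟩
      have h2 := Multiset.cons_erase hb
      rw [h] at h2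
      have h3 := hm.symm.trans h2.symm
      exact (Multiset.cons_inj_left _).1 h3
    rw [Multiset.map_congr rfl key]
    have hsum : ∀ l : Multiset ℕ,
        (l.map fun b => if a = b then (1 : ZMod 2) else 0).sum = (l.count a : ℕ) := by
      intro l
      induction l using Multiset.induction_on with
      | empty => simp
      | cons b l ih =>
        rw [Multiset.map_cons, Multiset.sum_cons, ih, Multiset.count_cons]
        split_ifs <;> push_cast <;> ring
    rw [hsum]
    have had := hle a ha
    rcases had.lt_or_eq with h | rfl
    · have h1 : Multiset.count a (Multiset.range d) = 1 :=
        Multiset.count_eq_one_of_mem (Multiset.nodup_range d) (Multiset.mem_range.2 h)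
      rw [if_neg]
      · rw [hm, Multiset.count_cons_self, h1]
        rfl
      · intro h2
        have := Multiset.nodup_range (d + 1)
        rw [← h2, hm, Multiset.nodup_cons] at this
        exact this.1 (Multiset.mem_range.2 h)
    · rw [if_pos (by rw [hm, Multiset.range_succ]), hm, Multiset.count_cons_self,
        Multiset.count_eq_zero_of_notMem (by simp)]
      simp
  · push Not at h
    rw [if_neg]
    · refine Multiset.sum_eq_zero fun x hx => ?_
      obtain ⟨a, ha, rfl⟩ := Multiset.mem_map.1 hx
      exact if_neg (h a ha)
    · rintro rfl
      refine h d (by simp) ?_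
      rw [Multiset.range_succ, Multiset.erase_cons_head]

section Chains

variable {ι : Type*} [DecidableEq ι] (c : (ι → ℕ) → ℕ)

theorem chainSum_add (d : ℕ) (S : Finset ι) (v : ι → ℕ) (G H : Multiset ℕ → ZMod 2) :
    chainSum c d S v (fun m => G m + H m) = chainSum c d S v G + chainSum c d S v H := by
  induction d generalizing S v G H with
  | zero => rfl
  | succ d ih => simp only [chainSum, ih, Finset.sum_add_distrib]

/-- Only multisets of `d + 1` labels occurring on the unit cube at `v` in the directions of `S`
matter for `chainSum`. -/
theorem chainSum_congr (d : ℕ) (S : Finset ι) (v : ι → ℕ) (G H : Multiset ℕ → ZMod 2)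
    (h : ∀ m : Multiset ℕ, m.card = d + 1 →
      (∀ a ∈ m, ∃ w, v ≤ w ∧ (∀ i, w i ≤ v i + 1) ∧ (∀ i ∉ S, w i = v i) ∧ c w = a) →
      G m = H m) :
    chainSum c d S v G = chainSum c d S v H := by
  induction d generalizing S v G H with
  | zero =>
    refine h _ (by simp) fun a ha => ⟨v, le_rfl, fun i => Nat.le_succ _, fun i _ => rfl, ?_⟩
    exact (Multiset.mem_singleton.1 ha).symm
  | succ d ih =>
    refine Finset.sum_congr rfl fun i hi => ih _ _ _ _ fun m hm hw => ?_
    refine h _ (by simp [hm]) fun a ha => ?_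
    rcases Multiset.mem_cons.1 ha with rfl | ha
    · exact ⟨v, le_rfl, fun i => Nat.le_succ _, fun i _ => rfl, rfl⟩
    obtain ⟨w, h1, h2, h3, h4⟩ := hw a ha
    refine ⟨w, fun j => le_trans (by simp) (h1 j), fun j => ?_, fun j hj => ?_, h4⟩
    · by_cases hji : j = i
      · subst hji
        simpa using (h3 j (by simp)).le
      · simpa [hji] using h2 j
    · have hji : j ≠ i := fun e => hj (e ▸ hi)
      simpa [hji] using h3 j (by simp [hj])

theorem sum_erase_comm (S : Finset ι) (f : ι → ι → ZMod 2) :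
    ∑ i ∈ S, ∑ j ∈ S.erase i, f i j = ∑ j ∈ S, ∑ i ∈ S.erase j, f i j := by
  refine Finset.sum_comm' fun i j => ?_
  simp only [Finset.mem_erase]
  tauto

theorem sum_erase_eq_zero_of_symm (S : Finset ι) (f : ι → ι → ZMod 2)
    (hf : ∀ i j, f i j = f j i) : ∑ i ∈ S, ∑ j ∈ S.erase i, f i j = 0 := by
  rw [Finset.sum_sigma']
  refine Finset.sum_involution (fun p _ => ⟨p.2, p.1⟩) ?_ ?_ ?_ ?_
  · rintro ⟨i, j⟩ _
    simp only [hf i j, CharTwo.add_self_eq_zero]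
  · rintro ⟨i, j⟩ h _ e
    simp only [Finset.mem_sigma, Finset.mem_erase] at h
    simp only [Sigma.mk.injEq] at e
    exact h.2.1 e.1
  · rintro ⟨i, j⟩ h
    simp only [Finset.mem_sigma, Finset.mem_erase] at h ⊢
    exact ⟨h.2.2, h.2.1.symm, h.1⟩
  · rintro ⟨i, j⟩ _
    rfl

/-- Boundary formula: modulo `2`, the facets interior to a cube cancel, because the facet obtained
by leaving out an inner point of a chain belongs to exactly two chains (swap the two steps around
this point). What remains are the chains in the facets of the cube. -/
theorem chainSum_facetSum (d : ℕ) (S : Finset ι) (v : ι → ℕ) (G : Multiset ℕ → ZMod 2) :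
    chainSum c (d + 1) S v (facetSum G) =
      ∑ i ∈ S, (chainSum c d (S.erase i) (v + Pi.single i 1) G +
        chainSum c d (S.erase i) v G) := by
  induction d generalizing S v G with
  | zero =>
    refine Finset.sum_congr rfl fun i _ => ?_
    rw [chainSum, chainSum, facetSum_cons]
    simp [chainSum, facetSum]
  | succ d ih =>
    rw [chainSum]
    simp only [facetSum_cons, chainSum_add c, ih, Finset.sum_add_distrib]
    congr 1
    rw [sum_erase_eq_zero_of_symm, zero_add]
    · rw [sum_erase_comm]
      refine Finset.sum_congr rfl fun j _ => Finset.sum_congr rfl fun i _ => ?_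
      rw [Finset.erase_right_comm]
    · intro i j
      rw [Finset.erase_right_comm, add_right_comm]

end Chains

/-! ### Kuhn's lemma -/

section Kuhn

variable {n : ℕ}

/-- The lattice box `[0, k)^S × {0}^(Sᶜ)`. -/
def latticeBox (k : ℕ) (S : Finset (Fin n)) : Finset (Fin n → ℕ) :=
  Fintype.piFinset fun i => if i ∈ S then Finset.range k else {0}

theorem mem_latticeBox {k : ℕ} {S : Finset (Fin n)} {v : Fin n → ℕ} :
    v ∈ latticeBox k S ↔ ∀ i, (i ∈ S → v i < k) ∧ (i ∉ S → v i = 0) := by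
  rw [latticeBox, Fintype.mem_piFinset]
  refine forall_congr' fun i => ?_
  by_cases h : i ∈ S <;> simp [h]

/-- Modulo `2`, the contributions of neighbouring cubes along direction `i` cancel. -/
theorem sum_latticeBox_telescope (k : ℕ) (S : Finset (Fin n)) (i : Fin n) (hi : i ∈ S)
    (F : (Fin n → ℕ) → ZMod 2) :
    ∑ v ∈ latticeBox k S, (F (v + Pi.single i 1) + F v) =
      ∑ v ∈ latticeBox k (S.erase i), (F (v + Pi.single i k) + F v) := by
  have htel : ∀ w : Fin n → ℕ, F (w + Pi.single i k) + F w =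
      ∑ t ∈ Finset.range k, (F (w + Pi.single i t + Pi.single i 1) + F (w + Pi.single i t)) := by
    intro w
    induction k with
    | zero => simp [CharTwo.add_self_eq_zero]
    | succ k ih =>
      rw [Finset.sum_range_succ, ← ih, add_assoc w, ← Pi.single_add]
      linear_combination -(CharTwo.add_self_eq_zero (F (w + Pi.single i k)))
  simp only [htel]
  rw [← Finset.sum_product']
  refine Finset.sum_nbij' (fun v => (Function.update v i 0, v i))
    (fun p => p.1 + Pi.single i p.2) ?_ ?_ ?_ ?_ ?_
  · intro v hv
    rw [mem_latticeBox] at hv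
    rw [Finset.mem_product, mem_latticeBox, Finset.mem_range]
    refine ⟨fun j => ?_, (hv i).1 hi⟩
    by_cases hj : j = i
    · subst hj; simp
    · simpa [hj] using hv j
  · rintro ⟨w, t⟩ h
    rw [Finset.mem_product, mem_latticeBox, Finset.mem_range] at h
    rw [mem_latticeBox]
    intro j
    by_cases hj : j = i
    · subst hj
      have : w j = 0 := (h.1 j).2 (by simp)
      simpa [hi, this] using h.2
    · simpa [hj] using h.1 j
  · intro v _
    funext j
    by_cases hj : j = i
    · subst hj; simp
    · simp [hj]
  · rintro ⟨w, t⟩ h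
    rw [Finset.mem_product, mem_latticeBox] at h
    have := (h.1 i).2 (by simp)
    simp only [Prod.mk.injEq]
    refine ⟨?_, by simpa using this⟩
    funext j
    by_cases hj : j = i
    · subst hj; simpa using this.symm
    · simp [hj]
  · intro v _
    have : Function.update v i 0 + Pi.single i (v i) = v := by
      funext j
      by_cases hj : j = i
      · subst hj; simp
      · simp [hj]
    simp only [this]

variable (k : ℕ) (c : (Fin n → ℕ) → ℕ)

/-- The parity statement behind Kuhn's lemma: in the box spanned by the first `d` directions, the
number of simplices labelled `0, …, d` is odd. -/
theorem sum_chainSum_range_eq_one (hn : ∀ v, c v ≤ n)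
    (h0 : ∀ v, (∀ i, v i ≤ k) → ∀ i : Fin n, v i = 0 → c v ≤ i)
    (h1 : ∀ v, (∀ i, v i ≤ k) → ∀ i : Fin n, v i = k → c v ≠ i) (d : ℕ) (hd : d ≤ n) :
    ∑ v ∈ latticeBox k (Finset.univ.filter fun i : Fin n => (i : ℕ) < d),
      chainSum c d (Finset.univ.filter fun i : Fin n => (i : ℕ) < d) v
        (fun m => if m = Multiset.range (d + 1) then 1 else 0) = 1 := by
  induction d with
  | zero =>
    have hc : c 0 = 0 := by
      rcases Nat.eq_zero_or_pos n with h | h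
      · exact Nat.le_zero.1 (h ▸ hn 0)
      · exact Nat.le_zero.1 (h0 0 (fun _ => Nat.zero_le _) ⟨0, h⟩ rfl)
    have hbox : latticeBox k (Finset.univ.filter fun i : Fin n => (i : ℕ) < 0) = {0} := by
      ext v
      simp [mem_latticeBox, funext_iff]
    rw [hbox, Finset.sum_singleton, chainSum, hc]
    rfl
  | succ d ih =>
    set S := Finset.univ.filter fun i : Fin n => (i : ℕ) < d + 1 with hS
    have hmem : ∀ i, i ∈ S ↔ (i : ℕ) < d + 1 := by simp [hS]
    have hstep : ∀ v ∈ latticeBox k S,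
        chainSum c (d + 1) S v (fun m => if m = Multiset.range (d + 1 + 1) then 1 else 0) =
        chainSum c (d + 1) S v
          (facetSum fun m => if m = Multiset.range (d + 1) then 1 else 0) := by
      intro v hv
      rw [mem_latticeBox] at hv
      refine chainSum_congr c _ _ _ _ _ fun m hm hw => ?_
      rw [facetSum_range (d + 1) m hm]
      intro a ha
      obtain ⟨w, hw1, hw2, hw3, rfl⟩ := hw a ha
      rcases hd.lt_or_eq with h | h
      · -- The box lies in the face where coordinate `d + 1` vanishes.
        have hnot : (⟨d + 1, h⟩ : Fin n) ∉ S := by simp [hmem]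
        refine h0 w (fun i => ?_) ⟨d + 1, h⟩ ((hw3 _ hnot).trans ((hv _).2 hnot))
        by_cases hi : i ∈ S
        · exact (hw2 i).trans ((hv i).1 hi)
        · rw [hw3 i hi, (hv i).2 hi]
          exact Nat.zero_le _
      · exact (hn w).trans h.ge
    rw [Finset.sum_congr rfl hstep]
    simp only [chainSum_facetSum]
    rw [Finset.sum_comm]
    rw [Finset.sum_congr rfl fun i hi => sum_latticeBox_telescope k S i hi fun v =>
      chainSum c d (S.erase i) v (fun m => if m = Multiset.range (d + 1) then 1 else 0)]
    -- A cube with no vertex labelled `a ≤ d` contributes nothing.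
    have hvanish : ∀ (T : Finset (Fin n)) (v : Fin n → ℕ) (a : ℕ), a ≤ d →
        (∀ w, v ≤ w → (∀ i, w i ≤ v i + 1) → (∀ i ∉ T, w i = v i) → c w ≠ a) →
        chainSum c d T v (fun m => if m = Multiset.range (d + 1) then 1 else 0) = 0 := by
      intro T v a ha h
      have hz : chainSum c d T v (fun _ => 0) = 0 := by
        have := chainSum_add c d T v (fun _ => 0) (fun _ => 0)
        simpa using this
      refine (chainSum_congr c _ _ _ _ _ fun m _ hw => if_neg ?_).trans hz
      rintro rfl
      obtain ⟨w, hw1, hw2, hw3, hw4⟩ := hw a (Multiset.mem_range.2 (Nat.lt_succ_of_le ha))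
      exact h w hw1 hw2 hw3 hw4
    have hbound : ∀ (i : Fin n), ∀ v ∈ latticeBox k (S.erase i), ∀ (j : Fin n) (t : ℕ),
        t ≤ v j + 1 → (j ∉ S.erase i → t = v j) → t ≤ k := by
      intro i v hv j t h2 h3
      rw [mem_latticeBox] at hv
      by_cases hjS : j ∈ S.erase i
      · exact h2.trans ((hv j).1 hjS)
      · rw [h3 hjS, (hv j).2 hjS]
        exact Nat.zero_le _
    have hfar : ∀ i ∈ S, ∀ v ∈ latticeBox k (S.erase i),
        chainSum c d (S.erase i) (v + Pi.single i k)
          (fun m => if m = Multiset.range (d + 1) then 1 else 0) = 0 := by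
      intro i hi v hv
      refine hvanish _ _ i (Nat.lt_succ_iff.1 ((hmem i).1 hi)) fun w hw1 hw2 hw3 => ?_
      have hvi : v i = 0 := (mem_latticeBox.1 hv i).2 (by simp)
      have hwi : w i = k := by simpa [hvi] using hw3 i (by simp)
      refine h1 w (fun j => ?_) i hwi
      by_cases hj : j = i
      · rw [hj, hwi]
      · refine hbound i v hv j _ (by simpa [hj] using hw2 j) fun h => ?_
        simpa [hj] using hw3 j h
    have hnear : ∀ i ∈ S, i ≠ ⟨d, hd⟩ → ∀ v ∈ latticeBox k (S.erase i),
        chainSum c d (S.erase i) v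
          (fun m => if m = Multiset.range (d + 1) then 1 else 0) = 0 := by
      intro i hi hid v hv
      have hlt : (i : ℕ) < d := by
        have h1 := (hmem i).1 hi
        have h2 : (i : ℕ) ≠ d := fun h => hid (Fin.ext h)
        omega
      refine hvanish _ _ d le_rfl fun w hw1 hw2 hw3 => ?_
      have hvi : v i = 0 := (mem_latticeBox.1 hv i).2 (by simp)
      have hwi : w i = 0 := (hw3 i (by simp)).trans hvi
      exact ((h0 w (fun j => hbound i v hv j _ (hw2 j) (hw3 j)) i hwi).trans_lt hlt).ne
    rw [Finset.sum_eq_single_of_mem (⟨d, hd⟩ : Fin n) (by simp [hmem])]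
    · have hS' : S.erase ⟨d, hd⟩ = Finset.univ.filter fun i : Fin n => (i : ℕ) < d := by
        ext i
        simp only [Finset.mem_erase, hmem, Finset.mem_filter_univ, ne_eq, Fin.ext_iff]
        omega
      rw [Finset.sum_congr rfl fun v hv => by
        rw [hfar _ (by simp [hmem]) v hv, zero_add], hS']
      exact ih (by omega)
    · intro i hi hid
      refine Finset.sum_eq_zero fun v hv => ?_
      rw [hfar i hi v hv, hnear i hi hid v hv, add_zero]

/-- **Kuhn's lemma**, the cubical form of Sperner's lemma. -/
theorem exists_unit_cube_all_labels (hn : ∀ v, c v ≤ n)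
    (h0 : ∀ v, (∀ i, v i ≤ k) → ∀ i : Fin n, v i = 0 → c v ≤ i)
    (h1 : ∀ v, (∀ i, v i ≤ k) → ∀ i : Fin n, v i = k → c v ≠ i) :
    ∃ v : Fin n → ℕ, (∀ i, v i < k) ∧
      ∀ a ≤ n, ∃ w, v ≤ w ∧ (∀ i, w i ≤ v i + 1) ∧ c w = a := by
  have h := sum_chainSum_range_eq_one k c hn h0 h1 n le_rfl
  have huniv : (Finset.univ.filter fun i : Fin n => (i : ℕ) < n) = Finset.univ := by simp
  rw [huniv] at h
  obtain ⟨v, hv, hne⟩ := Finset.exists_ne_zero_of_sum_ne_zero (h.trans_ne one_ne_zero)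
  refine ⟨v, fun i => (mem_latticeBox.1 hv i).1 (Finset.mem_univ i), ?_⟩
  by_contra! hcon
  obtain ⟨a, ha, hcon⟩ := hcon
  refine hne ((chainSum_congr c _ _ _ _ (fun _ => 0 + 0) fun m _ hw => ?_).trans ?_)
  · rw [if_neg, add_zero]
    rintro rfl
    obtain ⟨w, hw1, hw2, -, hw4⟩ := hw a (Multiset.mem_range.2 (Nat.lt_succ_of_le ha))
    exact hcon w hw1 hw2 hw4
  · rw [chainSum_add c n _ v (fun _ => 0) fun _ => 0, CharTwo.add_self_eq_zero]

end Kuhn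

/-! ### The covering theorem -/

/-- Lebesgue's covering theorem for the unit cube: a cover by closed sets `F 0, …, F n` has a
common point if, for every coordinate `i`, the face `x i = 0` avoids `F j` for all `j > i` and the
face `x i = 1` avoids `F i`. -/
theorem nonempty_iInter_of_closed_cover_cube (n : ℕ) (F : ℕ → Set (Fin n → ℝ))
    (hclosed : ∀ j, IsClosed (F j)) (hcover : ∀ x ∈ Set.Icc (0 : Fin n → ℝ) 1, ∃ j ≤ n, x ∈ F j)
    (h0 : ∀ x ∈ Set.Icc (0 : Fin n → ℝ) 1, ∀ i j, x i = 0 → x ∈ F j → j ≤ i)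
    (h1 : ∀ x ∈ Set.Icc (0 : Fin n → ℝ) 1, ∀ i : Fin n, x i = 1 → x ∉ F i) :
    ∃ x, ∀ j ≤ n, x ∈ F j := by
  -- Off the cube the label `0` is a harmless default.
  have hlabel : ∀ x : Fin n → ℝ, ∃ j ≤ n, x ∈ Set.Icc (0 : Fin n → ℝ) 1 → x ∈ F j := by
    intro x
    by_cases hx : x ∈ Set.Icc (0 : Fin n → ℝ) 1
    · obtain ⟨j, hj, hxj⟩ := hcover x hx
      exact ⟨j, hj, fun _ => hxj⟩
    · exact ⟨0, Nat.zero_le _, fun h => absurd h hx⟩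
  choose l hln hl using hlabel
  let p : ℕ → (Fin n → ℕ) → Fin n → ℝ := fun k v i => (v i : ℝ) / (k + 1)
  have hp : ∀ k v, (∀ i, v i ≤ k + 1) → p k v ∈ Set.Icc (0 : Fin n → ℝ) 1 := by
    intro k v hv
    refine ⟨fun i => ?_, fun i => ?_⟩
    · simp only [p, Pi.zero_apply]; positivity
    · simp only [p, Pi.one_apply]
      rw [div_le_one (by positivity)]
      exact_mod_cast hv i
  have hkuhn : ∀ k : ℕ, ∃ v : Fin n → ℕ, (∀ i, v i < k + 1) ∧
      ∀ a ≤ n, ∃ w, v ≤ w ∧ (∀ i, w i ≤ v i + 1) ∧ l (p k w) = a := by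
    intro k
    refine exists_unit_cube_all_labels (k + 1) (fun v => l (p k v))
      (fun v => hln _) (fun v hv i hi => ?_) (fun v hv i hi he => ?_)
    · exact h0 _ (hp k v hv) i _ (by simp [p, hi]) (hl _ (hp k v hv))
    · refine h1 _ (hp k v hv) i ?_ (he ▸ hl _ (hp k v hv))
      simp only [p, hi]
      push_cast
      exact div_self (by positivity)
  choose v hv w hw1 hw2 hw3 using hkuhn
  obtain ⟨x, -, φ, hφ, hx⟩ := (isCompact_Icc (a := (0 : Fin n → ℝ)) (b := 1)).tendsto_subseq
    fun k => hp k (v k) fun i => (hv k i).le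
  refine ⟨x, fun j hj => ?_⟩
  refine (hclosed j).mem_of_tendsto (f := fun k => p (φ k) (w (φ k) j hj)) (b := Filter.atTop) ?_
    (Filter.Eventually.of_forall fun k => ?_)
  · rw [tendsto_pi_nhds] at hx ⊢
    intro i
    have hε : Filter.Tendsto (fun k => (p (φ k) (v (φ k)) i) + 1 / ((φ k : ℝ) + 1)) Filter.atTop
        (nhds (x i)) := by
      simpa using (hx i).add (tendsto_one_div_add_atTop_nhds_zero_nat.comp hφ.tendsto_atTop)
    refine tendsto_of_tendsto_of_tendsto_of_le_of_le (hx i) hε (fun k => ?_) (fun k => ?_)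
    · simp only [p, Function.comp_apply]
      gcongr
      exact hw1 (φ k) j hj i
    · simp only [p]
      rw [← add_div]
      gcongr
      exact_mod_cast hw2 (φ k) j hj i
  · have := hl _ (hp (φ k) (w (φ k) j hj) fun i => (hw2 _ _ _ i).trans (hv _ i))
    rwa [hw3] at this

theorem corollary1p3 (n : ℕ) (hn : 1 ≤ n) :
    ¬ ∃ D : Set (Set (EuclideanSpace ℝ (Fin n))),
      IsDecomposition D ∧ IsLocallyFiniteCollection D ∧ HasBoundedDiameters D ∧
        MeetAtMost n D := by
  classical
  rintro ⟨D, hD, hfin, ⟨s, hs⟩, hmeet⟩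
  -- `e` maps the unit cube onto a cube whose side exceeds the diameter of every piece.
  let e : (Fin n → ℝ) → EuclideanSpace ℝ (Fin n) := fun x => WithLp.toLp 2 (((s : ℝ) + 1) • x)
  have he : Continuous e := (PiLp.continuous_toLp 2 _).comp (continuous_const_smul _)
  let Q : Set (Fin n → ℝ) := Set.Icc 0 1
  let P : Set (EuclideanSpace ℝ (Fin n)) → ℕ → Prop := fun A j =>
    ∃ x ∈ Q, e x ∈ A ∧ ∀ h : j < n, x ⟨j, h⟩ = 0
  -- The colour of a piece `A` is the first `i` such that `A` meets the face `x i = 0`, or `n`.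
  let col : Set (EuclideanSpace ℝ (Fin n)) → ℕ := fun A =>
    if h : ∃ j, P A j then Nat.find h else n
  have hcol_le : ∀ A j, P A j → col A ≤ j := by
    intro A j h
    simp only [col, dif_pos (⟨j, h⟩ : ∃ j, P A j)]
    exact Nat.find_min' _ h
  have hcol_spec : ∀ A x, x ∈ Q → e x ∈ A → P A (col A) ∧ col A ≤ n := by
    intro A x hx hxA
    have hPn : P A n := ⟨x, hx, hxA, fun h => absurd h (lt_irrefl n)⟩
    refine ⟨?_, hcol_le A n hPn⟩
    simp only [col, dif_pos (⟨n, hPn⟩ : ∃ j, P A j)]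
    exact Nat.find_spec (⟨n, hPn⟩ : ∃ j, P A j)
  let 𝒜 : ℕ → Set (Set (EuclideanSpace ℝ (Fin n))) := fun j =>
    {A ∈ {A ∈ D | (A ∩ e '' Q).Nonempty} | col A = j}
  have hmem : ∀ x ∈ Q, ∀ A ∈ D, e x ∈ A → A ∈ 𝒜 (col A) := fun x hx A hA hxA =>
    ⟨⟨hA, ⟨e x, hxA, x, hx, rfl⟩⟩, rfl⟩
  have hcommon : ∃ x, ∀ j ≤ n, x ∈ Q ∩ ⋃ A ∈ 𝒜 j, e ⁻¹' A := by
    refine nonempty_iInter_of_closed_cover_cube n (fun j => Q ∩ ⋃ A ∈ 𝒜 j, e ⁻¹' A)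
      ?_ ?_ ?_ ?_
    · intro j
      refine isClosed_Icc.inter (Set.Finite.isClosed_biUnion ?_ fun A hA => ?_)
      · exact (hfin _ (isCompact_Icc.image he)).subset fun A hA => hA.1
      · exact (hD.isClosed A hA.1.1).preimage he
    · intro x hx
      have : e x ∈ ⋃₀ D := hD.sUnion_eq ▸ Set.mem_univ _
      obtain ⟨A, hA, hxA⟩ := this
      exact ⟨col A, (hcol_spec A x hx hxA).2, hx, Set.mem_biUnion (hmem x hx A hA hxA) hxA⟩
    · rintro x hx i j hi ⟨-, hxj⟩
      simp only [Set.mem_iUnion] at hxj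
      obtain ⟨A, hA, hxA⟩ := hxj
      rw [← hA.2]
      exact hcol_le A i ⟨x, hx, hxA, fun _ => hi⟩
    · rintro x hx i hi ⟨-, hxj⟩
      simp only [Set.mem_iUnion] at hxj
      obtain ⟨A, hA, hxA⟩ := hxj
      obtain ⟨y, hy, hyA, hy0⟩ := (hcol_spec A x hx hxA).1
      -- The piece `A` would meet the opposite faces `x i = 0` and `x i = 1`.
      have hyi : y i = 0 := by
        have hci : col A = i := hA.2
        simp only [hci, Fin.eta] at hy0
        exact hy0 i.2
      have h1 : edist (e x) (e y) ≤ s :=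
        (Metric.edist_le_ediam_of_mem (x := e x) hxA hyA).trans (hs A hA.1.1)
      have h2 : dist (e x) (e y) ≤ s := by
        rw [edist_nndist] at h1
        exact_mod_cast h1
      have h3 : dist (e x i) (e y i) ≤ dist (e x) (e y) := by
        rw [dist_eq_norm, dist_eq_norm]
        exact PiLp.norm_apply_le (e x - e y) i
      have h4 : dist (e x i) (e y i) = s + 1 := by
        simp only [e, Pi.smul_apply, hi, hyi, smul_eq_mul, mul_one, mul_zero, dist_zero_right]
        rw [Real.norm_of_nonneg (by positivity)]
      linarith
  obtain ⟨x, hx⟩ := hcommon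
  have hpieces : ∀ j : Fin (n + 1), ∃ A ∈ D, e x ∈ A ∧ col A = j := by
    intro j
    obtain ⟨-, hxj⟩ := hx j (Nat.lt_succ_iff.1 j.2)
    simp only [Set.mem_iUnion] at hxj
    obtain ⟨A, hA, hxA⟩ := hxj
    exact ⟨A, hA.1.1, hxA, hA.2⟩
  choose A hAD hxA hcol using hpieces
  have hinj : Function.Injective A := fun i j hij =>
    Fin.ext ((hcol i).symm.trans ((congrArg col hij).trans (hcol j)))
  have h1 : (Set.range A).encard = n + 1 := by
    rw [← Set.image_univ, hinj.encard_image, Set.encard_univ]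
    simp
  have h2 := (Set.encard_le_encard (s := Set.range A) (t := {A ∈ D | e x ∈ A})
    (by rintro _ ⟨j, rfl⟩; exact ⟨hAD j, hxA j⟩)).trans (hmeet (e x))
  rw [h1] at h2
  have : n + 1 ≤ n := by exact_mod_cast h2
  omega
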